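/- Let $\Sigma$ be a $\sigma$-finite measure space, let $L^2(\Sigma)$ be its complex $L^2$-space, and for $f\in L^2(\Sigma^2)$ let $S_f\in B(L^2(\Sigma))$ be the Hilbert--Schmidt operator with kernel $f$, $(S_fh)(s)=\int_\Sigma f(s,t)h(t)\,dt$. For $\varphi\in L^\infty(\Sigma^2)$ let $M_\varphi$ be the operator $S_f\mapsto S_{\varphi f}$ on the Hilbert--Schmidt operators of $L^2(\Sigma)$. Let $H$ be a complex Hilbert space, with inner product linear in the first variable, and let $\alpha,\beta\in L^\infty(\Sigma,H)$ (Bochner space) be such that $$\varphi(s,t)=\langle\alpha(s),\beta(t)\rangle_H\quad\text{for almost every }(s,t)\in\Sigma\times\Sigma.$$ Then $M_\varphi$ has a unique $w^*$-continuous linear extension $M_\varphi^\infty:B(L^2(\Sigma))\to B(L^2(\Sigma))$, where the $w^*$-topology is that of $B(L^2(\Sigma))$ as the dual of the trace class operators, and $M_\varphi^\infty$ is unital (that is, $M_\varphi^\infty(I)=I$) if and only if $$\langle\alpha(t),\beta(t)\rangle_H=1\quad\text{for almost every }t\in\Sigma.$$ -/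

import Mathlib

open MeasureTheory
open scoped ENNReal Topology

namespace SchurMult

section KernelOperator

variable {Ω : Type*} [MeasurableSpace Ω] {μ : Measure Ω} [SigmaFinite μ]

theorem lintegral_enorm_kernel_sq_le {f : Ω × Ω → ℂ} {h : Ω → ℂ}
    (hf : MemLp f 2 (μ.prod μ)) (hh : MemLp h 2 μ) :
    ∫⁻ s, ‖∫ t, f (s, t) * h t ∂μ‖ₑ ^ (2 : ℝ) ∂μ ≤
      (∫⁻ p, ‖f p‖ₑ ^ (2 : ℝ) ∂(μ.prod μ)) * ∫⁻ t, ‖h t‖ₑ ^ (2 : ℝ) ∂μ := by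
  have hfm := hf.aestronglyMeasurable
  have hhm := hh.aestronglyMeasurable
  have hne : ∫⁻ t, ‖h t‖ₑ ^ (2 : ℝ) ∂μ ≠ ∞ := by
    have := (eLpNorm_lt_top_iff_lintegral_rpow_enorm_lt_top (by norm_num) (by norm_num)).1
      hh.eLpNorm_lt_top
    simpa using this.ne
  rw [lintegral_prod _ (hfm.enorm.pow_const _), ← lintegral_mul_const' _ _ hne]
  refine lintegral_mono_ae ?_
  filter_upwards [hfm.prodMk_left] with s hs
  have h1 : ‖∫ t, f (s, t) * h t ∂μ‖ₑ ≤
      (∫⁻ t, ‖f (s, t)‖ₑ ^ (2 : ℝ) ∂μ) ^ (1 / (2 : ℝ)) *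
        (∫⁻ t, ‖h t‖ₑ ^ (2 : ℝ) ∂μ) ^ (1 / (2 : ℝ)) := by
    refine (enorm_integral_le_lintegral_enorm _).trans ?_
    simp only [enorm_mul]
    exact ENNReal.lintegral_mul_le_Lp_mul_Lq μ Real.HolderConjugate.two_two hs.enorm hhm.enorm
  calc _ ≤ _ := ENNReal.rpow_le_rpow h1 (by norm_num)
    _ = _ := by
      rw [ENNReal.mul_rpow_of_nonneg _ _ (by norm_num), ← ENNReal.rpow_mul, ← ENNReal.rpow_mul]
      norm_num

theorem aestronglyMeasurable_kernel {f : Ω × Ω → ℂ} {h : Ω → ℂ}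
    (hf : MemLp f 2 (μ.prod μ)) (hh : MemLp h 2 μ) :
    AEStronglyMeasurable (fun s => ∫ t, f (s, t) * h t ∂μ) μ :=
  (hf.aestronglyMeasurable.mul
    hh.aestronglyMeasurable.comp_snd).integral_prod_right'

theorem eLpNorm_kernel_le {f : Ω × Ω → ℂ} {h : Ω → ℂ}
    (hf : MemLp f 2 (μ.prod μ)) (hh : MemLp h 2 μ) :
    eLpNorm (fun s => ∫ t, f (s, t) * h t ∂μ) 2 μ ≤
      eLpNorm f 2 (μ.prod μ) * eLpNorm h 2 μ := by
  simp only [eLpNorm_eq_lintegral_rpow_enorm_toReal (p := 2) (by norm_num) (by norm_num),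
    ENNReal.toReal_ofNat]
  rw [← ENNReal.mul_rpow_of_nonneg _ _ (by norm_num)]
  exact ENNReal.rpow_le_rpow (lintegral_enorm_kernel_sq_le hf hh) (by norm_num)

theorem memLp_kernel {f : Ω × Ω → ℂ} {h : Ω → ℂ}
    (hf : MemLp f 2 (μ.prod μ)) (hh : MemLp h 2 μ) :
    MemLp (fun s => ∫ t, f (s, t) * h t ∂μ) 2 μ :=
  ⟨aestronglyMeasurable_kernel hf hh, (eLpNorm_kernel_le hf hh).trans_lt
    (ENNReal.mul_lt_top hf.eLpNorm_lt_top hh.eLpNorm_lt_top)⟩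

theorem ae_integrable_kernel {f : Ω × Ω → ℂ} {h : Ω → ℂ}
    (hf : MemLp f 2 (μ.prod μ)) (hh : MemLp h 2 μ) :
    ∀ᵐ s ∂μ, Integrable (fun t => f (s, t) * h t) μ := by
  have h2 := (eLpNorm_lt_top_iff_lintegral_rpow_enorm_lt_top (by norm_num) (by norm_num)).1
      hf.eLpNorm_lt_top
  rw [lintegral_prod _ (hf.aestronglyMeasurable.enorm.pow_const _)] at h2
  have h3 := ae_lt_top' (hf.aestronglyMeasurable.enorm.pow_const _).lintegral_prod_right' h2.ne
  filter_upwards [h3, hf.aestronglyMeasurable.prodMk_left] with s hs hm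
  have : MemLp (fun t => f (s, t)) 2 μ :=
    ⟨hm, (eLpNorm_lt_top_iff_lintegral_rpow_enorm_lt_top (by norm_num) (by norm_num)).2 hs⟩
  exact this.integrable_mul hh

/-- The function `S_f h = ∫ f(·, t) h(t) dt` in `L²(Ω)`, for `f ∈ L²(Ω × Ω)` and `h ∈ L²(Ω)`. -/
noncomputable def kernelFun (f : Lp ℂ 2 (μ.prod μ)) (h : Lp ℂ 2 μ) : Lp ℂ 2 μ :=
  (memLp_kernel (Lp.memLp f) (Lp.memLp h)).toLp (fun s => ∫ t, f (s, t) * h t ∂μ)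

theorem kernelFun_add (f : Lp ℂ 2 (μ.prod μ)) (h k : Lp ℂ 2 μ) :
    kernelFun f (h + k) = kernelFun f h + kernelFun f k := by
  unfold kernelFun
  rw [← MemLp.toLp_add]
  refine MemLp.toLp_congr _ _ ?_
  filter_upwards [ae_integrable_kernel (Lp.memLp f) (Lp.memLp h),
    ae_integrable_kernel (Lp.memLp f) (Lp.memLp k)] with s hs ks
  rw [Pi.add_apply, ← integral_add hs ks]
  refine integral_congr_ae ?_
  filter_upwards [Lp.coeFn_add h k] with t ht
  rw [ht, Pi.add_apply, mul_add]

theorem kernelFun_smul (f : Lp ℂ 2 (μ.prod μ)) (c : ℂ) (h : Lp ℂ 2 μ) :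
    kernelFun f (c • h) = c • kernelFun f h := by
  unfold kernelFun
  rw [← MemLp.toLp_const_smul]
  refine MemLp.toLp_congr _ _ (Filter.Eventually.of_forall fun s => ?_)
  simp only [Pi.smul_apply, smul_eq_mul]
  rw [← integral_const_mul]
  refine integral_congr_ae ?_
  filter_upwards [Lp.coeFn_smul c h] with t ht
  rw [ht, Pi.smul_apply, smul_eq_mul]
  ring

theorem norm_kernelFun_le (f : Lp ℂ 2 (μ.prod μ)) (h : Lp ℂ 2 μ) :
    ‖kernelFun f h‖ ≤ ‖f‖ * ‖h‖ := by
  unfold kernelFun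
  rw [Lp.norm_toLp, Lp.norm_def, Lp.norm_def, ← ENNReal.toReal_mul]
  exact ENNReal.toReal_mono
    (ENNReal.mul_ne_top (Lp.eLpNorm_ne_top f) (Lp.eLpNorm_ne_top h))
    (eLpNorm_kernel_le (Lp.memLp f) (Lp.memLp h))

/-- The Hilbert-Schmidt operator `S_f` on `L²(Ω)` with kernel `f ∈ L²(Ω × Ω)`:
`(S_f h)(s) = ∫ f(s, t) h(t) dt`. -/
noncomputable def kernelOp (f : Lp ℂ 2 (μ.prod μ)) : Lp ℂ 2 μ →L[ℂ] Lp ℂ 2 μ :=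
  LinearMap.mkContinuous
    { toFun := kernelFun f
      map_add' := kernelFun_add f
      map_smul' := kernelFun_smul f }
    ‖f‖ (norm_kernelFun_le f)

end KernelOperator

section WStar

variable {K : Type*} [NormedAddCommGroup K] [InnerProductSpace ℂ K]

/-- The `w*`-topology (σ-weak topology) of `B(K)`, as the dual of the trace class: the coarsest
topology for which the functionals `x ↦ tr(xρ)` are continuous for all trace class operators
`ρ = ∑ₙ ⟨·, gₙ⟩ fₙ` with `∑ ‖fₙ‖² < ∞` and `∑ ‖gₙ‖² < ∞`,
that is, `tr(xρ) = ∑ₙ ⟨x fₙ, gₙ⟩`. -/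
@[reducible] noncomputable def wStarTopology (K : Type*) [NormedAddCommGroup K] [InnerProductSpace ℂ K] :
    TopologicalSpace (K →L[ℂ] K) :=
  ⨅ (f : ℕ → K) (g : ℕ → K) (_ : Summable fun n => ‖f n‖ ^ 2) (_ : Summable fun n => ‖g n‖ ^ 2),
    TopologicalSpace.induced (fun x : K →L[ℂ] K => ∑' n, inner ℂ (g n) (x (f n))) inferInstance

/-- Continuity of a map `B(K) → B(K)` for the `w*`-topology on both sides. -/
def IsWStarContinuous (T : (K →L[ℂ] K) → (K →L[ℂ] K)) : Prop :=
  Continuous[wStarTopology K, wStarTopology K] T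

end WStar

variable {Ω : Type*} [MeasurableSpace Ω] {μ : Measure Ω} [SigmaFinite μ]

/-- `T` is a `w*`-continuous linear extension to `B(L²(Ω))` of the operator
`M_φ : S_f ↦ S_{φ f}` on the Hilbert-Schmidt operators of `L²(Ω)`. -/
structure IsWStarExtension (φ : Lp ℂ ∞ (μ.prod μ))
    (T : (Lp ℂ 2 μ →L[ℂ] Lp ℂ 2 μ) →ₗ[ℂ] (Lp ℂ 2 μ →L[ℂ] Lp ℂ 2 μ)) : Prop where
  wStarContinuous : IsWStarContinuous T
  extends_schur : ∀ f : Lp ℂ 2 (μ.prod μ),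
    T (kernelOp f) = kernelOp (φ • f : Lp ℂ 2 (μ.prod μ))

end SchurMult

namespace SchurMult

/-! ### The w*-topology, the maps `T ↦ ∑ aᵢ* T bᵢ`, and w*-density of finite rank. -/

section Abstract

open Filter

variable {K : Type*} [NormedAddCommGroup K] [InnerProductSpace ℂ K]

/-! Expand `⟨α(s), β(t)⟩ = ∑ᵢ ⟨α(s), eᵢ⟩ ⟨eᵢ, β(t)⟩` (linear in the first variable) along a
countable orthonormal family. Let `aᵢ*` and `bᵢ` be multiplication by `⟨α, eᵢ⟩` and `⟨eᵢ, β⟩`. By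
Bessel both columns are bounded, so `T ↦ ∑ aᵢ* T bᵢ` (`sandwich`) is defined on all of `B(L²)`, and
it is w*-continuous. It multiplies a kernel `f(s, t)` by `φ` (`sandwich_kernelOp`), so it extends
the Schur multiplier. It sends `I` to multiplication by `⟨α(t), β(t)⟩` (`sandwich_one`). Thus the
diagonal, possibly null in the product, is reached through `α` and `β` rather than through `φ`.

Uniqueness: rank one operators have L² kernels, and finite rank operators are w*-dense. -/

theorem tendsto_wStar_iff {X : Type*} {l : Filter X} {u : X → K →L[ℂ] K} {x : K →L[ℂ] K} :
    Tendsto u l (@nhds _ (wStarTopology K) x) ↔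
      ∀ f g : ℕ → K, (Summable fun n => ‖f n‖ ^ 2) → (Summable fun n => ‖g n‖ ^ 2) →
        Tendsto (fun i => ∑' n, inner ℂ (g n) (u i (f n))) l
          (𝓝 (∑' n, inner ℂ (g n) (x (f n)))) := by
  simp only [nhds_iInf, nhds_induced, tendsto_iInf, tendsto_comap_iff]
  rfl

theorem isWStarContinuous_iff {T : (K →L[ℂ] K) → (K →L[ℂ] K)} :
    IsWStarContinuous T ↔ ∀ f g : ℕ → K, (Summable fun n => ‖f n‖ ^ 2) →
      (Summable fun n => ‖g n‖ ^ 2) →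
        Continuous[wStarTopology K, inferInstance]
          fun x => ∑' n, inner ℂ (g n) (T x (f n)) := by
  unfold IsWStarContinuous
  simp only [continuous_iInf_rng, continuous_induced_rng]
  rfl

/-- The functional given by a trace class operator is `w*`-continuous, whatever countable set
indexes the sum that represents it. -/
theorem continuous_wStar_tsum_inner {κ : Type*} [Countable κ] {f g : κ → K}
    (hf : Summable fun n => ‖f n‖ ^ 2) (hg : Summable fun n => ‖g n‖ ^ 2) :
    Continuous[wStarTopology K, inferInstance]
      fun x : K →L[ℂ] K => ∑' n, inner ℂ (g n) (x (f n)) := by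
  -- Reindex by `ℕ`, padding both sequences with zeros.
  obtain ⟨j, hj⟩ := exists_injective_nat κ
  have aux : ∀ f : κ → K, (Summable fun n => ‖f n‖ ^ 2) →
      Summable fun n => ‖Function.extend j f 0 n‖ ^ 2 := fun f hf => by
    refine (hj.summable_iff fun n hn => ?_).1 ?_
    · rw [Function.extend_apply' _ _ _ hn]; simp
    · simpa only [Function.comp_def, hj.extend_apply] using hf
  have key : (fun x : K →L[ℂ] K => ∑' n, inner ℂ (g n) (x (f n))) = fun x : K →L[ℂ] K =>
      ∑' n, inner ℂ (Function.extend j g 0 n) (x (Function.extend j f 0 n)) := by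
    ext x
    rw [← hj.tsum_eq]
    · simp only [hj.extend_apply]
    · intro n hn
      by_contra hn'
      exact hn (by simp only [Function.extend_apply' _ _ _ hn', Pi.zero_apply, inner_zero_left])
  rw [key]
  exact (isWStarContinuous_iff (T := id)).1 (@continuous_id _ (wStarTopology K)) _ _
    (aux f hf) (aux g hg)

variable {ι : Type*}

/-- The column `(cᵢ)` is a bounded operator `K → ℓ²(ι, K)` of norm at most `C`. -/
def IsBoundedColumn (c : ι → K →L[ℂ] K) (C : ℝ) : Prop :=
  0 ≤ C ∧ ∀ (F : Finset ι) (h : K), ∑ i ∈ F, ‖c i h‖ ^ 2 ≤ (C * ‖h‖) ^ 2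

theorem IsBoundedColumn.summable {c : ι → K →L[ℂ] K} {C : ℝ} (hc : IsBoundedColumn c C) (h : K) :
    Summable fun i => ‖c i h‖ ^ 2 :=
  summable_of_sum_le (fun _ => by positivity) fun F => hc.2 F h

theorem IsBoundedColumn.comp {c : ι → K →L[ℂ] K} {C : ℝ} (hc : IsBoundedColumn c C)
    (T : K →L[ℂ] K) : IsBoundedColumn (fun i => T ∘L c i) (‖T‖ * C) := by
  refine ⟨mul_nonneg (norm_nonneg _) hc.1, fun F h => ?_⟩
  calc ∑ i ∈ F, ‖(T ∘L c i) h‖ ^ 2 ≤ ∑ i ∈ F, ‖T‖ ^ 2 * ‖c i h‖ ^ 2 := by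
        refine Finset.sum_le_sum fun i _ => ?_
        rw [← mul_pow]
        exact pow_le_pow_left₀ (norm_nonneg _) (T.le_opNorm _) 2
    _ ≤ ‖T‖ ^ 2 * (C * ‖h‖) ^ 2 := by
        rw [← Finset.mul_sum]
        exact mul_le_mul_of_nonneg_left (hc.2 F h) (by positivity)
    _ = _ := by ring

/-- The operator `K → ℓ²(ι, K)` given by a bounded column. -/
noncomputable def IsBoundedColumn.toCLM {c : ι → K →L[ℂ] K} {C : ℝ} (hc : IsBoundedColumn c C) :
    K →L[ℂ] lp (fun _ : ι => K) 2 :=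
  LinearMap.mkContinuous
    { toFun := fun h => ⟨fun i => c i h, memℓp_gen' (C := (C * ‖h‖) ^ 2) fun F => by
        simpa using hc.2 F h⟩
      map_add' := fun h k => by ext i; exact map_add (c i) h k
      map_smul' := fun z h => by ext i; exact map_smul (c i) z h }
    C fun h => lp.norm_le_of_forall_sum_le (by norm_num) (mul_nonneg hc.1 (norm_nonneg _))
      fun F => by simpa using hc.2 F h

theorem IsBoundedColumn.summable_prod {c : ι → K →L[ℂ] K} {C : ℝ} (hc : IsBoundedColumn c C)
    {f : ℕ → K} (hf : Summable fun n => ‖f n‖ ^ 2) :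
    Summable fun p : ℕ × ι => ‖c p.2 (f p.1)‖ ^ 2 := by
  rw [summable_prod_of_nonneg fun _ => by positivity]
  refine ⟨fun n => hc.summable (f n), ?_⟩
  refine Summable.of_nonneg_of_le (fun n => tsum_nonneg fun i => by positivity) (fun n => ?_)
    (hf.mul_left (C ^ 2))
  rw [← mul_pow]
  exact (hc.summable (f n)).tsum_le_of_sum_le fun F => hc.2 F (f n)

variable [CompleteSpace K] {a b : ι → K →L[ℂ] K} {A B : ℝ}

/-- The map `T ↦ ∑ᵢ aᵢ* T bᵢ` on `B(K)`. -/
noncomputable def sandwich (ha : IsBoundedColumn a A) (hb : IsBoundedColumn b B) :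
    (K →L[ℂ] K) →ₗ[ℂ] (K →L[ℂ] K) where
  toFun T := ContinuousLinearMap.adjoint ha.toCLM ∘L (hb.comp T).toCLM
  map_add' S T := by
    have : (hb.comp (S + T)).toCLM = (hb.comp S).toCLM + (hb.comp T).toCLM := by ext; rfl
    rw [this, ContinuousLinearMap.comp_add]
  map_smul' z T := by
    have : (hb.comp (z • T)).toCLM = z • (hb.comp T).toCLM := by ext; rfl
    rw [this, ContinuousLinearMap.comp_smul]
    rfl

theorem hasSum_inner_sandwich (ha : IsBoundedColumn a A) (hb : IsBoundedColumn b B)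
    (T : K →L[ℂ] K) (k h : K) :
    HasSum (fun i => inner ℂ (a i k) (T (b i h))) (inner ℂ k (sandwich ha hb T h)) := by
  change HasSum _ (inner ℂ k (ContinuousLinearMap.adjoint ha.toCLM ((hb.comp T).toCLM h)))
  rw [ContinuousLinearMap.adjoint_inner_right]
  exact lp.hasSum_inner _ _

/-- The map has a preadjoint: the trace class operator given by `(fₙ, gₙ)` pulls back to the one
given by `(bᵢ fₙ, aᵢ gₙ)`, indexed by `ℕ × ι`. -/
theorem isWStarContinuous_sandwich [Countable ι] (ha : IsBoundedColumn a A)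
    (hb : IsBoundedColumn b B) : IsWStarContinuous (sandwich ha hb) := by
  rw [isWStarContinuous_iff]
  intro f g hf hg
  have hf' := hb.summable_prod hf
  have hg' := ha.summable_prod hg
  convert continuous_wStar_tsum_inner hf' hg' using 2 with x
  have hs : Summable fun p : ℕ × ι => inner ℂ (a p.2 (g p.1)) (x (b p.2 (f p.1))) := by
    refine Summable.of_norm_bounded (((hf'.mul_left (‖x‖ ^ 2)).add hg')) fun p => ?_
    refine (norm_inner_le_norm _ _).trans ?_
    have h1 := x.le_opNorm (b p.2 (f p.1))
    have h2 := norm_nonneg (a p.2 (g p.1))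
    have h3 := mul_le_mul_of_nonneg_left h1 h2
    nlinarith [sq_nonneg (‖x‖ * ‖b p.2 (f p.1)‖ - ‖a p.2 (g p.1)‖),
      sq_nonneg (‖x‖ * ‖b p.2 (f p.1)‖), sq_nonneg ‖a p.2 (g p.1)‖]
  rw [hs.tsum_prod]
  exact tsum_congr fun n => (hasSum_inner_sandwich ha hb x (g n) (f n)).tsum_eq.symm

/-- Finite rank operators are `w*`-dense in `B(K)`: the compressions of `x` by the finite partial
sums of the identity along a Hilbert basis converge to `x`. -/
theorem tendsto_wStar_sum_rankOne {κ : Type*} (e : HilbertBasis κ ℂ K) (x : K →L[ℂ] K) :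
    Tendsto (fun F : Finset κ => ∑ i ∈ F, InnerProductSpace.rankOne ℂ (e i)
      (ContinuousLinearMap.adjoint x (e i))) atTop (@nhds _ (wStarTopology K) x) := by
  rw [tendsto_wStar_iff]
  intro f g hf hg
  -- The approximants are `P_F x`, with `P_F` the projection onto the span of the `eᵢ`, `i ∈ F`;
  -- hence the bound `‖x‖ ‖fₙ‖`, uniform in `F`.
  have happ : ∀ (F : Finset κ) (h : K), (∑ i ∈ F, InnerProductSpace.rankOne ℂ (e i)
      (ContinuousLinearMap.adjoint x (e i))) h = ∑ i ∈ F, inner ℂ (e i) (x h) • e i := by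
    intro F h
    simp [ContinuousLinearMap.adjoint_inner_left]
  simp only [happ]
  refine tendsto_tsum_of_dominated_convergence
    (bound := fun n => ‖x‖ ^ 2 * ‖f n‖ ^ 2 + ‖g n‖ ^ 2) ((hf.mul_left _).add hg) (fun n => ?_)
    (Eventually.of_forall fun F n => ?_)
  · have := (innerSL ℂ (g n)).hasSum (e.hasSum_repr (x (f n)))
    simpa only [Function.comp_def, e.repr_apply_apply, HasSum, innerSL_apply_apply, ← inner_sum,
      SummationFilter.unconditional_filter] using this
  · have h0 : ‖∑ i ∈ F, inner ℂ (e i) (x (f n)) • e i‖ ≤ ‖x‖ * ‖f n‖ := by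
      refine le_trans ?_ (x.le_opNorm _)
      rw [← sq_le_sq₀ (norm_nonneg _) (norm_nonneg _)]
      have h1 := e.orthonormal.orthogonalFamily.norm_sum (fun i => inner ℂ (e i) (x (f n))) F
      simp only [LinearIsometry.toSpanSingleton_apply] at h1
      rw [h1]
      exact e.orthonormal.sum_inner_products_le _
    refine (norm_inner_le_norm _ _).trans ?_
    have h3 := mul_le_mul_of_nonneg_left h0 (norm_nonneg (g n))
    nlinarith [sq_nonneg (‖x‖ * ‖f n‖ - ‖g n‖), sq_nonneg (‖x‖ * ‖f n‖), sq_nonneg ‖g n‖]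

/-- A `w*`-continuous linear map is determined by its values on rank one operators. -/
theorem eq_of_isWStarContinuous_of_rankOne {S T : (K →L[ℂ] K) →ₗ[ℂ] (K →L[ℂ] K)}
    (hS : IsWStarContinuous S) (hT : IsWStarContinuous T)
    (h : ∀ u v : K, S (InnerProductSpace.rankOne ℂ u v) = T (InnerProductSpace.rankOne ℂ u v)) :
    S = T := by
  obtain ⟨w, e, -⟩ := exists_hilbertBasis ℂ K
  refine LinearMap.ext fun x => ContinuousLinearMap.ext fun y => ext_inner_left ℂ fun z => ?_
  have test : ∀ {U : (K →L[ℂ] K) →ₗ[ℂ] (K →L[ℂ] K)}, IsWStarContinuous U →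
      Tendsto (fun F : Finset w => ∑ i ∈ F, inner ℂ z (U (InnerProductSpace.rankOne ℂ (e i)
      (ContinuousLinearMap.adjoint x (e i))) y)) atTop (𝓝 (inner ℂ z (U x y))) := by
    intro U hU
    -- Sequences supported at `0` realise the matrix coefficient `⟨U x y, z⟩` as a w*-continuous
    -- functional.
    have hs : ∀ z : K, Summable fun n : ℕ => ‖(Pi.single 0 z : ℕ → K) n‖ ^ 2 := fun z =>
      summable_of_ne_finset_zero (s := {0}) fun n hn => by
        rw [Pi.single_eq_of_ne (by simpa using hn)]; simp
    have h1 := @Continuous.tendsto _ _ (wStarTopology K) _ _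
      ((isWStarContinuous_iff.1 hU) (Pi.single 0 y) (Pi.single 0 z) (hs y) (hs z)) x
    have h2 := h1.comp (tendsto_wStar_sum_rankOne e x)
    have h3 : ∀ V : K →L[ℂ] K, ∑' n, inner ℂ ((Pi.single 0 z : ℕ → K) n)
        (V ((Pi.single 0 y : ℕ → K) n)) = inner ℂ z (V y) := fun V => by
      rw [tsum_eq_single 0 fun n hn => by rw [Pi.single_eq_of_ne hn, inner_zero_left]]
      simp
    simpa only [Function.comp_def, h3, map_sum, _root_.sum_apply, inner_sum] using h2
  have hS' := test hS
  simp only [h] at hS'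
  exact tendsto_nhds_unique hS' (test hT)

end Abstract

/-! ### Countable orthonormal expansions of vector-valued functions. -/

section Expansion

open Filter

variable {H : Type*} [NormedAddCommGroup H] [InnerProductSpace ℂ H]

/-- The essential range of a strongly measurable function is spanned by a countable orthonormal
family. -/
theorem exists_countable_orthonormal_hasSum_inner.{u, v} {X : Type u} [MeasurableSpace X]
    {ν : Measure X} {H : Type v} [NormedAddCommGroup H] [InnerProductSpace ℂ H] [CompleteSpace H]
    {α : X → H} (hα : AEStronglyMeasurable α ν) :
    ∃ (ι : Type v) (_ : Countable ι) (e : ι → H), Orthonormal ℂ e ∧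
      ∀ᵐ x ∂ν, ∀ v : H, HasSum (fun i => inner ℂ v (e i) * inner ℂ (e i) (α x))
        (inner ℂ v (α x)) := by
  obtain ⟨w, b, -⟩ := exists_hilbertBasis ℂ H
  obtain ⟨t, ⟨d, hd, htd⟩, hαt⟩ := hα.isSeparable_ae_range
  have hcount : ∀ y : H, {i | inner ℂ (b i) y ≠ 0}.Countable := fun y => by
    have := (b.orthonormal.inner_products_summable y).countable_support
    simpa [Function.support] using this
  -- Each `y` in the countable dense set `d` has countably many nonzero coefficients. Vanishing of a
  -- coefficient is a closed condition, so it passes to almost every `α x`.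
  set S : Set w := ⋃ y ∈ d, {i | inner ℂ (b i) y ≠ 0}
  have hS : S.Countable := hd.biUnion fun y _ => hcount y
  refine ⟨S, hS.to_subtype, fun i => b i, b.orthonormal.comp _ Subtype.val_injective, ?_⟩
  filter_upwards [hαt] with x hx v
  have hz : ∀ i ∉ S, inner ℂ (b i) (α x) = 0 := fun i hi => by
    have hcl : IsClosed {y : H | inner ℂ (b i) y = 0} :=
      isClosed_eq (continuous_const.inner continuous_id) continuous_const
    refine closure_minimal (fun y hy => ?_) hcl (htd hx)
    by_contra hne
    exact hi (Set.mem_biUnion hy hne)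
  refine (hasSum_subtype_iff_of_support_subset (s := S)
    (f := fun i => inner ℂ v (b i) * inner ℂ (b i) (α x)) fun i hi => ?_).2
    (b.hasSum_inner_mul_inner v (α x))
  by_contra h
  exact hi (by simp only [hz i h, mul_zero])

theorem norm_sum_inner_mul_inner_le {ι : Type*} {e : ι → H} (he : Orthonormal ℂ e) (F : Finset ι)
    {u v : H} {C : ℝ} (hu : ‖u‖ ≤ C) (hv : ‖v‖ ≤ C) :
    ‖∑ i ∈ F, inner ℂ v (e i) * inner ℂ (e i) u‖ ≤ C ^ 2 := by
  have h : ‖∑ i ∈ F, inner ℂ v (e i) * inner ℂ (e i) u‖ ≤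
      ∑ i ∈ F, (‖inner ℂ (e i) v‖ ^ 2 + ‖inner ℂ (e i) u‖ ^ 2) / 2 := by
    refine norm_sum_le_of_le _ fun i _ => ?_
    rw [norm_mul, norm_inner_symm]
    nlinarith [sq_nonneg (‖inner ℂ (e i) v‖ - ‖inner ℂ (e i) u‖)]
  rw [← Finset.sum_div, Finset.sum_add_distrib] at h
  have h1 := he.sum_inner_products_le (s := F) v
  have h2 := he.sum_inner_products_le (s := F) u
  have h3 := pow_le_pow_left₀ (norm_nonneg u) hu 2
  have h4 := pow_le_pow_left₀ (norm_nonneg v) hv 2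
  linarith

/-- Termwise integration of the expansion of `⟨u, v⟩` along a countable orthonormal family. -/
theorem hasSum_integral_inner_mul_inner {X : Type*} [MeasurableSpace X] {ν : Measure X}
    {ι : Type*} [Countable ι] {e : ι → H} (he : Orthonormal ℂ e) {u v : X → H} {w : X → ℂ} {C : ℝ}
    (hum : AEStronglyMeasurable u ν) (hvm : AEStronglyMeasurable v ν)
    (hu : ∀ᵐ x ∂ν, ‖u x‖ ≤ C) (hv : ∀ᵐ x ∂ν, ‖v x‖ ≤ C) (hw : Integrable w ν)
    (h : ∀ᵐ x ∂ν, HasSum (fun i => inner ℂ (v x) (e i) * inner ℂ (e i) (u x))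
      (inner ℂ (v x) (u x))) :
    HasSum (fun i => ∫ x, inner ℂ (v x) (e i) * inner ℂ (e i) (u x) * w x ∂ν)
      (∫ x, inner ℂ (v x) (u x) * w x ∂ν) := by
  have hm : ∀ F : Finset ι, AEStronglyMeasurable
      (fun x => ∑ i ∈ F, inner ℂ (v x) (e i) * inner ℂ (e i) (u x)) ν := fun F =>
    Finset.aestronglyMeasurable_fun_sum _ fun i _ =>
      (hvm.inner aestronglyMeasurable_const).mul (aestronglyMeasurable_const.inner hum)
  have hb : ∀ F : Finset ι, ∀ᵐ x ∂ν,
      ‖∑ i ∈ F, inner ℂ (v x) (e i) * inner ℂ (e i) (u x)‖ ≤ C ^ 2 := fun F => by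
    filter_upwards [hu, hv] with x hux hvx
    exact norm_sum_inner_mul_inner_le he F hux hvx
  have hint : ∀ i, Integrable (fun x => inner ℂ (v x) (e i) * inner ℂ (e i) (u x) * w x) ν :=
    fun i => by
      have := hw.bdd_mul (hm {i}) (hb {i})
      simpa only [Finset.sum_singleton] using this
  -- Countability of `ι` makes `atTop` on finite sets countably generated, as dominated convergence
  -- requires.
  have key := tendsto_integral_filter_of_dominated_convergence (μ := ν) (l := atTop)
    (F := fun (F : Finset ι) x => (∑ i ∈ F, inner ℂ (v x) (e i) * inner ℂ (e i) (u x)) * w x)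
    (f := fun x => inner ℂ (v x) (u x) * w x) (fun x => C ^ 2 * ‖w x‖)
    (Eventually.of_forall fun F => (hm F).mul hw.aestronglyMeasurable)
    (Eventually.of_forall fun F => by
      filter_upwards [hb F] with x hx
      rw [norm_mul]
      exact mul_le_mul_of_nonneg_right hx (norm_nonneg _))
    (hw.norm.const_mul _)
    (by
      filter_upwards [h] with x hx
      rw [HasSum, SummationFilter.unconditional_filter] at hx
      exact hx.mul_const _)
  rw [HasSum, SummationFilter.unconditional_filter]
  refine key.congr fun F => ?_
  rw [← integral_finsetSum _ fun i _ => hint i]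
  simp only [Finset.sum_mul]

theorem exists_ae_norm_le {X E : Type*} [MeasurableSpace X] {ν : Measure X}
    [NormedAddCommGroup E] (α : Lp E ∞ ν) :
    ∃ C : ℝ, 0 ≤ C ∧ ∀ᵐ x ∂ν, ‖α x‖ ≤ C := by
  refine ⟨‖α‖, norm_nonneg _, ?_⟩
  filter_upwards [ae_le_eLpNormEssSup (f := α) (μ := ν)] with x hx
  have h := Lp.eLpNorm_ne_top α
  rw [eLpNorm_exponent_top] at h
  rw [Lp.norm_def, eLpNorm_exponent_top, ← toReal_enorm]
  exact ENNReal.toReal_mono h hx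

end Expansion

/-! ### Multiplication operators and the image of the identity. -/

section Multiplication

variable {Ω : Type*} [MeasurableSpace Ω] {μ : Measure Ω}

/-- The operator on `L²(Ω)` of multiplication by an essentially bounded function. -/
noncomputable def mulOp {c : Ω → ℂ} (hc : MemLp c ∞ μ) : Lp ℂ 2 μ →L[ℂ] Lp ℂ 2 μ :=
  (ContinuousLinearMap.mul ℂ ℂ).holderL μ ∞ 2 2 hc.toLp

theorem coeFn_mulOp {c : Ω → ℂ} (hc : MemLp c ∞ μ) (h : Lp ℂ 2 μ) :
    mulOp hc h =ᵐ[μ] fun t => c t * h t := by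
  filter_upwards [(ContinuousLinearMap.mul ℂ ℂ).coeFn_holder (r := 2) hc.toLp h, hc.coeFn_toLp]
    with t h1 h2
  rw [← h2]
  exact h1

theorem memLp_two_mul_prod {u v : Ω → ℂ} (hu : MemLp u 2 μ) (hv : MemLp v 2 μ) :
    MemLp (fun p : Ω × Ω => u p.1 * v p.2) 2 (μ.prod μ) := by
  have hm : AEStronglyMeasurable (fun p : Ω × Ω => u p.1 * v p.2) (μ.prod μ) :=
    hu.aestronglyMeasurable.comp_fst.mul hv.aestronglyMeasurable.comp_snd
  rw [memLp_two_iff_integrable_sq_norm hm]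
  simp only [norm_mul, mul_pow]
  exact ((memLp_two_iff_integrable_sq_norm hu.aestronglyMeasurable).1 hu).mul_prod
    ((memLp_two_iff_integrable_sq_norm hv.aestronglyMeasurable).1 hv)

theorem integrable_kernel_mul (f : Lp ℂ 2 (μ.prod μ)) (k h : Lp ℂ 2 μ) :
    Integrable (fun p => f p * (star (k p.1) * h p.2)) (μ.prod μ) :=
  (Lp.memLp f).integrable_mul (memLp_two_mul_prod (Lp.memLp k).star (Lp.memLp h))

variable {H : Type*} [NormedAddCommGroup H] [InnerProductSpace ℂ H]

/-- Bessel's inequality for `γ t` at almost every `t`, then integration. -/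
theorem isBoundedColumn_mulOp {ι : Type*} {e : ι → H} (he : Orthonormal ℂ e) (γ : Lp H ∞ μ)
    {C : ℝ} (hC : 0 ≤ C) (hγ : ∀ᵐ t ∂μ, ‖γ t‖ ≤ C) :
    IsBoundedColumn (fun i => mulOp ((Lp.memLp γ).inner_const (𝕜 := ℂ) (e i))) C := by
  refine ⟨hC, fun F h => ?_⟩
  have hsq : ∀ f : Lp ℂ 2 μ, ‖f‖ ^ 2 = ∫ t, ‖f t‖ ^ 2 ∂μ := fun f => by
    have := L2.inner_def (𝕜 := ℂ) f f
    simp only [inner_self_eq_norm_sq_to_K] at this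
    rw [← Complex.ofReal_inj, ← integral_complex_ofReal]
    push_cast
    exact this
  have hi : ∀ f : Lp ℂ 2 μ, Integrable (fun t => ‖f t‖ ^ 2) μ := fun f =>
    (memLp_two_iff_integrable_sq_norm (Lp.aestronglyMeasurable f)).1 (Lp.memLp f)
  rw [mul_pow]
  simp only [hsq]
  rw [← integral_finsetSum _ fun i _ => hi _, ← integral_const_mul]
  refine integral_mono_ae (integrable_finsetSum _ fun i _ => hi _) ((hi h).const_mul _) ?_
  have hae : ∀ᵐ t ∂μ, ∀ i ∈ F, mulOp ((Lp.memLp γ).inner_const (𝕜 := ℂ) (e i)) h t =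
      inner ℂ (γ t) (e i) * h t :=
    (ae_ball_iff F.countable_toSet).2 fun i _ => coeFn_mulOp _ h
  filter_upwards [hae, hγ] with t ht hγt
  rw [Finset.sum_congr rfl fun i hi => by rw [ht i hi, norm_mul, norm_inner_symm, mul_pow],
    ← Finset.sum_mul]
  exact mul_le_mul_of_nonneg_right ((he.sum_inner_products_le (γ t)).trans
    (pow_le_pow_left₀ (norm_nonneg _) hγt 2)) (by positivity)

theorem memLp_top_inner {α β : Lp H ∞ μ} {C : ℝ}
    (hβα : ∀ᵐ t ∂μ, ‖α t‖ ≤ C ∧ ‖β t‖ ≤ C) :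
    MemLp (fun t => inner ℂ (β t) (α t)) ∞ μ := by
  refine memLp_top_of_bound ((Lp.aestronglyMeasurable β).inner (Lp.aestronglyMeasurable α))
    (C * C) ?_
  filter_upwards [hβα] with t ht
  exact (norm_inner_le_norm _ _).trans
    (mul_le_mul ht.2 ht.1 (norm_nonneg _) ((norm_nonneg _).trans ht.1))

theorem sandwich_one {ι : Type*} [Countable ι] {e : ι → H} {α β : Lp H ∞ μ} {C : ℝ}
    (he : Orthonormal ℂ e)
    (hexp : ∀ᵐ s ∂μ, ∀ v : H, HasSum (fun i => inner ℂ v (e i) * inner ℂ (e i) (α s))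
      (inner ℂ v (α s)))
    (hC : 0 ≤ C) (hα : ∀ᵐ t ∂μ, ‖α t‖ ≤ C) (hβ : ∀ᵐ t ∂μ, ‖β t‖ ≤ C) :
    sandwich (isBoundedColumn_mulOp he α hC hα) (isBoundedColumn_mulOp he β hC hβ) 1 =
      mulOp (memLp_top_inner (hα.and hβ)) := by
  refine ContinuousLinearMap.ext fun h => ext_inner_left ℂ fun k => ?_
  refine (hasSum_inner_sandwich _ _ _ k h).unique ?_
  convert hasSum_integral_inner_mul_inner he (Lp.aestronglyMeasurable α)
    (Lp.aestronglyMeasurable β) hα hβ (L2.integrable_inner (𝕜 := ℂ) k h)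
    (hexp.mono fun s hs => hs (β s)) using 1
  · ext i
    rw [one_apply_eq_self, L2.inner_def]
    refine integral_congr_ae ?_
    filter_upwards [coeFn_mulOp ((Lp.memLp α).inner_const (𝕜 := ℂ) (e i)) k,
      coeFn_mulOp ((Lp.memLp β).inner_const (𝕜 := ℂ) (e i)) h] with t h1 h2
    rw [h1, h2]
    simp only [RCLike.inner_apply, map_mul, inner_conj_symm]
    ring
  · rw [L2.inner_def]
    refine integral_congr_ae ?_
    filter_upwards [coeFn_mulOp (memLp_top_inner (hα.and hβ)) h] with t h1
    rw [h1]
    simp only [RCLike.inner_apply]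
    ring

end Multiplication

/-! ### Hilbert–Schmidt kernels and uniqueness. -/

section Kernel

variable {Ω : Type*} [MeasurableSpace Ω] {μ : Measure Ω} [SigmaFinite μ]

theorem inner_kernelOp (f : Lp ℂ 2 (μ.prod μ)) (k h : Lp ℂ 2 μ) :
    inner ℂ k (kernelOp f h) = ∫ p, f p * (star (k p.1) * h p.2) ∂(μ.prod μ) := by
  rw [integral_prod _ (integrable_kernel_mul f k h), L2.inner_def]
  refine integral_congr_ae ?_
  filter_upwards [(memLp_kernel (Lp.memLp f) (Lp.memLp h)).coeFn_toLp] with s hs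
  change inner ℂ (k s) (kernelFun f h s) = _
  rw [kernelFun, hs, RCLike.inner_apply, ← integral_mul_const]
  refine integral_congr_ae (Filter.Eventually.of_forall fun t => ?_)
  simp only [starRingEnd_apply]
  ring

/-- The kernel is `u(s)` times the conjugate of `v(t)`. -/
theorem exists_kernelOp_eq_rankOne (u v : Lp ℂ 2 μ) :
    ∃ f : Lp ℂ 2 (μ.prod μ), kernelOp f = InnerProductSpace.rankOne ℂ u v := by
  have hf : MemLp (fun p : Ω × Ω => u p.1 * star (v p.2)) 2 (μ.prod μ) :=
    memLp_two_mul_prod (Lp.memLp u) (Lp.memLp v).star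
  refine ⟨hf.toLp, ContinuousLinearMap.ext fun h => ext_inner_left ℂ fun k => ?_⟩
  rw [inner_kernelOp, InnerProductSpace.rankOne_apply, inner_smul_right, L2.inner_def, L2.inner_def,
    mul_comm, ← integral_prod_mul]
  refine integral_congr_ae ?_
  filter_upwards [hf.coeFn_toLp] with p hp
  simp only [hp, RCLike.inner_apply, starRingEnd_apply]
  ring

theorem IsWStarExtension.unique {φ : Lp ℂ ∞ (μ.prod μ)}
    {S T : (Lp ℂ 2 μ →L[ℂ] Lp ℂ 2 μ) →ₗ[ℂ] (Lp ℂ 2 μ →L[ℂ] Lp ℂ 2 μ)}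
    (hS : IsWStarExtension φ S) (hT : IsWStarExtension φ T) : S = T := by
  refine eq_of_isWStarContinuous_of_rankOne hS.wStarContinuous hT.wStarContinuous fun u v => ?_
  obtain ⟨f, hf⟩ := exists_kernelOp_eq_rankOne u v
  rw [← hf, hS.extends_schur, hT.extends_schur]

end Kernel

/-! ### The extension property and the unital criterion. -/

section Factorization

variable {Ω : Type*} [MeasurableSpace Ω] {μ : Measure Ω} [SigmaFinite μ]
  {H : Type*} [NormedAddCommGroup H] [InnerProductSpace ℂ H]
  {ι : Type*} [Countable ι] {e : ι → H} {α β : Lp H ∞ μ} {C : ℝ}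

theorem mulOp_eq_one_iff {c : Ω → ℂ} (hc : MemLp c ∞ μ) :
    mulOp hc = 1 ↔ ∀ᵐ t ∂μ, c t = 1 := by
  constructor
  · intro h
    -- The constant `1` need not be in L², so test on indicators of an exhaustion by sets of finite
    -- measure.
    have hn : ∀ n, ∀ᵐ t ∂μ, t ∈ spanningSets μ n → c t = 1 := fun n => by
      have h1 := coeFn_mulOp hc (indicatorConstLp 2 (measurableSet_spanningSets μ n)
        (measure_spanningSets_lt_top μ n).ne (1 : ℂ))
      rw [h] at h1
      filter_upwards [h1, indicatorConstLp_coeFn (p := 2) (hs := measurableSet_spanningSets μ n)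
        (hμs := (measure_spanningSets_lt_top μ n).ne) (c := (1 : ℂ))] with t ht1 ht2 ht
      rw [one_apply_eq_self, ht2, Set.indicator_of_mem ht, mul_one] at ht1
      exact ht1.symm
    filter_upwards [ae_all_iff.2 hn] with t ht
    exact ht _ (mem_spanningSetsIndex μ t)
  · intro h
    refine ContinuousLinearMap.ext fun k => Lp.ext ?_
    filter_upwards [coeFn_mulOp hc k, h] with t h1 h2
    rw [h1, h2, one_mul]
    rfl

/-- Compare matrix coefficients: termwise integration over the product, against the integrable
weight `f(s, t) conj(k(s)) h(t)`, sums the series to `φ f`. -/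
theorem sandwich_kernelOp (he : Orthonormal ℂ e)
    (hexp : ∀ᵐ s ∂μ, ∀ v : H, HasSum (fun i => inner ℂ v (e i) * inner ℂ (e i) (α s))
      (inner ℂ v (α s)))
    (hC : 0 ≤ C) (hα : ∀ᵐ t ∂μ, ‖α t‖ ≤ C) (hβ : ∀ᵐ t ∂μ, ‖β t‖ ≤ C)
    {φ : Lp ℂ ∞ (μ.prod μ)} (hφ : ∀ᵐ p ∂(μ.prod μ), φ p = inner ℂ (β p.2) (α p.1))
    (f : Lp ℂ 2 (μ.prod μ)) :
    sandwich (isBoundedColumn_mulOp he α hC hα) (isBoundedColumn_mulOp he β hC hβ) (kernelOp f) =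
      kernelOp (φ • f : Lp ℂ 2 (μ.prod μ)) := by
  have hfst := Measure.quasiMeasurePreserving_fst (μ := μ) (ν := μ)
  have hsnd := Measure.quasiMeasurePreserving_snd (μ := μ) (ν := μ)
  refine ContinuousLinearMap.ext fun h => ext_inner_left ℂ fun k => ?_
  refine (hasSum_inner_sandwich _ _ _ k h).unique ?_
  convert hasSum_integral_inner_mul_inner he (Lp.aestronglyMeasurable α).comp_fst
    (Lp.aestronglyMeasurable β).comp_snd (hfst.ae hα) (hsnd.ae hβ) (integrable_kernel_mul f k h)
    ((hfst.ae hexp).mono fun p hp => hp (β p.2)) using 1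
  · ext i
    rw [inner_kernelOp]
    refine integral_congr_ae ?_
    filter_upwards [hfst.ae (coeFn_mulOp ((Lp.memLp α).inner_const (𝕜 := ℂ) (e i)) k),
      hsnd.ae (coeFn_mulOp ((Lp.memLp β).inner_const (𝕜 := ℂ) (e i)) h)] with p h1 h2
    rw [h1, h2, star_mul', ← starRingEnd_apply, inner_conj_symm]
    ring
  · rw [inner_kernelOp]
    refine integral_congr_ae ?_
    filter_upwards [hφ, Lp.coeFn_lpSMul (r := 2) φ f] with p h1 h2
    rw [h2, Pi.smul_apply', h1, smul_eq_mul, mul_assoc]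

end Factorization

end SchurMult

theorem mainTheorem9 {Ω : Type*} [MeasurableSpace Ω] (μ : Measure Ω) [SigmaFinite μ]
    {H : Type*} [NormedAddCommGroup H] [InnerProductSpace ℂ H] [CompleteSpace H]
    (φ : Lp ℂ ∞ (μ.prod μ)) (α β : Lp H ∞ μ)
    (hφ : ∀ᵐ p ∂(μ.prod μ), φ p = inner ℂ (β p.2) (α p.1)) :
    ∃ M : (Lp ℂ 2 μ →L[ℂ] Lp ℂ 2 μ) →ₗ[ℂ] (Lp ℂ 2 μ →L[ℂ] Lp ℂ 2 μ),
      SchurMult.IsWStarExtension φ M ∧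
      (∀ M' : (Lp ℂ 2 μ →L[ℂ] Lp ℂ 2 μ) →ₗ[ℂ] (Lp ℂ 2 μ →L[ℂ] Lp ℂ 2 μ),
        SchurMult.IsWStarExtension φ M' → M' = M) ∧
      (M 1 = 1 ↔ ∀ᵐ t ∂μ, inner ℂ (β t) (α t) = 1) := by
  obtain ⟨ι, _, e, he, hexp⟩ :=
    SchurMult.exists_countable_orthonormal_hasSum_inner (Lp.aestronglyMeasurable α)
  obtain ⟨A, hA, hα⟩ := SchurMult.exists_ae_norm_le α
  obtain ⟨B, -, hβ⟩ := SchurMult.exists_ae_norm_le β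
  -- Termwise integration uses one bound for both functions.
  have hC : 0 ≤ max A B := le_max_of_le_left hA
  have hα' : ∀ᵐ t ∂μ, ‖α t‖ ≤ max A B := hα.mono fun t ht => le_max_of_le_left ht
  have hβ' : ∀ᵐ t ∂μ, ‖β t‖ ≤ max A B := hβ.mono fun t ht => le_max_of_le_right ht
  have hM : SchurMult.IsWStarExtension φ (SchurMult.sandwich
      (SchurMult.isBoundedColumn_mulOp he α hC hα') (SchurMult.isBoundedColumn_mulOp he β hC hβ')) :=
    ⟨SchurMult.isWStarContinuous_sandwich _ _,
      SchurMult.sandwich_kernelOp he hexp hC hα' hβ' hφ⟩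
  refine ⟨_, hM, fun M' hM' => hM'.unique hM, ?_⟩
  rw [SchurMult.sandwich_one he hexp hC hα' hβ', SchurMult.mulOp_eq_one_iff]
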